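/- Let $\mathbb X\subset\mathbb R^d$ be measurable, let $\pi$ and $q_i$ ($i=1,2,\dots$) be probability densities on $\mathbb X$ with respect to Lebesgue measure such that $q_i(x)\to\pi(x)$ for every $x\in\mathbb X$, and let $F:\mathbb X\to\mathbb R$ be measurable. For each $i$ let $\alpha_i(x,y)=\min\{1,\pi(y)q_i(x)/(\pi(x)q_i(y))\}$ if $\pi(x)q_i(y)>0$ and $\alpha_i(x,y)=1$ otherwise, and let $$P_i(x,dy)=\alpha_i(x,y)q_i(y)\,dy+\Bigl(1-\int\alpha_i(x,z)q_i(z)\,dz\Bigr)\delta_x(dy)$$ be the transition kernel of the independent Metropolis sampler $IM(P_i,\pi,q_i)$ with target $\pi$ and proposal $q_i$. Assume that for every $i$: (A1) the chain with kernel $P_i$ is $\psi$-irreducible and aperiodic, and $\pi(x)\,dx$ is its unique invariant probability measure; (A2) there is a measurable $W_i:\mathbb X\to[1,\infty)$ with $\sup_x |F(x)|/W_i(x)<\infty$, $\int W_i^4\,\pi\,dx<\infty$ and $\int W_i^4\,q_i\,dx<\infty$; (A3) $\sup_x \pi(x)/q_i(x)<\infty$ (with $a/0=\infty$ for $a>0$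 and $0/0=0$). A solution of the Poisson equation of $IM(P_i,\pi,q_i)$ for $F$ is a function $\hat F_i:\mathbb X\to\mathbb R$ such that, for every $x$ with $\pi(x)>0$, the following integral converges absolutely and $$\int\alpha_i(x,y)\,(\hat F_i(y)-\hat F_i(x))\,q_i(y)\,dy=-F(x)+\mathbb E_\pi[F].$$ Then for every $i$ such a solution exists. Moreover, for every sequence of solutions $\hat F_i$ one has, up to translation of each $\hat F_i$ by an additive constant (which again gives a solution), pointwise convergence to $F+c$ for some constant $c$: there are real numbers $a_i$ and $c$ with $$\lim_{i\to\infty}\bigl(\hat F_i(x)+a_i\bigr)=F(x)+c\qquad\text{for every }x\in\mathbb X\text{ with }\pi(x)>0 .$$ -/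

import Mathlib

open MeasureTheory ProbabilityTheory Filter Topology
open scoped ENNReal

namespace IndepMetropolis

variable {S : Type*} [MeasurableSpace S]

/-- A probability density on `S` with respect to the reference measure `μ`. -/
structure Density (μ : Measure S) where
  toFun : S → ℝ
  measurable_toFun : Measurable toFun
  nonneg : ∀ x, 0 ≤ toFun x
  integral_eq_one : ∫ x, toFun x ∂μ = 1

variable {μ : Measure S}

instance : CoeFun (Density μ) (fun _ => S → ℝ) := ⟨Density.toFun⟩

/-- The probability measure `p(x) dx` with density `p`. -/
noncomputable def Density.measure (p : Density μ) : Measure S :=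
  μ.withDensity fun x => ENNReal.ofReal (p x)

/-- The expectation `∫ F(x) p(x) dx` of `F` under the density `p`. -/
noncomputable def Density.expect (p : Density μ) (F : S → ℝ) : ℝ :=
  ∫ x, F x * p x ∂μ

open Classical in
/-- Acceptance probability of the independent Metropolis algorithm with target density `π` and
proposal density `q`. (Normalizing constants of `π` cancel.) -/
noncomputable def accept (π q : Density μ) (x y : S) : ℝ :=
  if 0 < π x * q y then min 1 (π y * q x / (π x * q y)) else 1

theorem accept_nonneg (π q : Density μ) (x y : S) : 0 ≤ accept π q x y := by
  unfold accept
  split_ifs with h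
  · exact le_min zero_le_one (div_nonneg (mul_nonneg (π.nonneg y) (q.nonneg x)) h.le)
  · exact zero_le_one

theorem measurable_accept (π q : Density μ) :
    Measurable fun z : S × S => accept π q z.1 z.2 := by
  have h1 := π.measurable_toFun
  have h2 := q.measurable_toFun
  unfold accept
  refine Measurable.ite (measurableSet_lt measurable_const ?_) ?_ measurable_const
  · fun_prop
  · fun_prop

instance (p : Density μ) : IsProbabilityMeasure p.measure := by
  have hi : Integrable p.toFun μ := by
    by_contra h
    have := p.integral_eq_one
    rw [integral_undef h] at this
    exact zero_ne_one this
  constructor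
  rw [Density.measure, withDensity_apply _ MeasurableSet.univ, Measure.restrict_univ,
    ← ofReal_integral_eq_lintegral_ofReal hi (Eventually.of_forall p.nonneg),
    p.integral_eq_one, ENNReal.ofReal_one]

/-- The probability `1 - ∫ α(x,z) q(z) dz` that the chain, being at `x`, rejects the proposal. -/
noncomputable def rejectProb (π q : Density μ) (x : S) : ℝ :=
  1 - ∫ z, accept π q x z * q z ∂μ

theorem measurable_rejectProb (π q : Density μ) : Measurable (rejectProb π q) := by
  have h : ∀ x, ∫ z, accept π q x z * q z ∂μ = ∫ z, accept π q x z ∂q.measure := by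
    intro x
    rw [Density.measure, integral_withDensity_eq_integral_toReal_smul
      q.measurable_toFun.ennreal_ofReal (by simp)]
    refine integral_congr_ae (Eventually.of_forall fun z => ?_)
    simp [ENNReal.toReal_ofReal (q.nonneg z), mul_comm]
  unfold rejectProb
  simp_rw [h]
  exact measurable_const.sub
    (measurable_accept π q).stronglyMeasurable.integral_prod_right.measurable

/-- The transition kernel
`P(x, dy) = α(x,y) q(y) dy + (1 - ∫ α(x,z) q(z) dz) δ_x(dy)`
of the independent Metropolis algorithm. -/
noncomputable def kernel (π q : Density μ) : Kernel S S where
  toFun x := (μ.withDensity fun y => ENNReal.ofReal (accept π q x y * q y)) +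
    ENNReal.ofReal (rejectProb π q x) • Measure.dirac x
  measurable' := by
    refine Measure.measurable_of_measurable_coe _ fun s hs => ?_
    have ha := measurable_accept π q
    have h : ∀ x, (μ.withDensity fun y => ENNReal.ofReal (accept π q x y * q y)) s
        = ∫⁻ y in s, ENNReal.ofReal (accept π q x y) ∂q.measure := by
      intro x
      have hx : Measurable fun y => ENNReal.ofReal (accept π q x y) :=
        (ha.comp (measurable_const.prodMk measurable_id)).ennreal_ofReal
      rw [withDensity_apply _ hs, Density.measure, restrict_withDensity hs,
        lintegral_withDensity_eq_lintegral_mul _ q.measurable_toFun.ennreal_ofReal hx]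
      refine lintegral_congr fun y => ?_
      rw [ENNReal.ofReal_mul (accept_nonneg π q x y), mul_comm]
      rfl
    simp only [Measure.add_apply, Measure.smul_apply, smul_eq_mul, h]
    refine Measurable.add ?_ ?_
    · exact ha.ennreal_ofReal.lintegral_prod_right'
    · exact (measurable_rejectProb π q).ennreal_ofReal.mul (Measure.measurable_coe hs |>.comp
        Measure.measurable_dirac)

/-- `ψ`-irreducibility: there is a nontrivial `σ`-finite irreducibility measure. -/
def PsiIrreducible (κ : Kernel S S) : Prop :=
  ∃ φ : Measure S, SigmaFinite φ ∧ φ ≠ 0 ∧ Kernel.IsIrreducible φ κ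

/-- Aperiodicity of a chain with stationary distribution `ν`: there is no `d ≥ 2` with pairwise
disjoint sets `D 0, …, D (d - 1)`, not `ν`-null, that the chain visits cyclically. -/
def Aperiodic (κ : Kernel S S) (ν : Measure S) : Prop :=
  ¬ ∃ (d : ℕ) (D : ZMod d → Set S), 2 ≤ d ∧ (∀ j, MeasurableSet (D j)) ∧
    Pairwise (Function.onFun Disjoint D) ∧ (∀ j, ∀ x ∈ D j, κ x (D (j + 1)) = 1) ∧ 0 < ν (D 0)

/-- `ν` is the unique invariant probability measure of `κ`. -/
def IsUniqueInvariant (κ : Kernel S S) (ν : Measure S) : Prop :=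
  Kernel.Invariant κ ν ∧
    ∀ ν' : Measure S, IsProbabilityMeasure ν' → Kernel.Invariant κ ν' → ν' = ν

/-- The chain of the sampler is `ψ`-irreducible and aperiodic with unique invariant measure
`π(x) dx`. -/
def RegularChain (π q : Density μ) : Prop :=
  PsiIrreducible (kernel π q) ∧ Aperiodic (kernel π q) π.measure ∧
    IsUniqueInvariant (kernel π q) π.measure

/-- `W ≥ 1` is a (measurable) weight, `F` has finite weighted sup-norm `sup |F| / W`, and
`∫ |W|⁴ π < ∞`, `∫ |W|⁴ q < ∞`. -/
structure MomentBound (π q : Density μ) (F W : S → ℝ) : Prop where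
  measurable_weight : Measurable W
  one_le_weight : ∀ x, 1 ≤ W x
  bddAbove_norm : BddAbove (Set.range fun x => |F x| / W x)
  integrable_target : Integrable (fun x => |W x| ^ 4 * π x) μ
  integrable_proposal : Integrable (fun x => |W x| ^ 4 * q x) μ

/-- `w⋆ = sup_x π(x) / q(x)`, in `[0, ∞]`. In `ℝ≥0∞`, `a / 0 = ∞` for `a ≠ 0` and `0 / 0 = 0`. -/
noncomputable def wStar (π q : Density μ) : ℝ≥0∞ :=
  ⨆ x, ENNReal.ofReal (π x) / ENNReal.ofReal (q x)

/-- `h` solves the Poisson equation of the sampler for `F`: at every `x` with `π(x) > 0`,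
`∫ α(x,y) (h(y) - h(x)) q(y) dy = - F(x) + E_π[F]`, the integral being absolutely convergent. -/
def IsPoissonSolution (π q : Density μ) (F h : S → ℝ) : Prop :=
  ∀ x, 0 < π x →
    Integrable (fun y => accept π q x y * (h y - h x) * q y) μ ∧
    ∫ y, accept π q x y * (h y - h x) * q y ∂μ = - F x + π.expect F

end IndepMetropolis

/-! Let `v = q / π` be the inverse weight and `ν = π dx`. Where `π x > 0`, `accept_mul_eq` turns
`α(x,y) q(y) dy` into the symmetric kernel `min (v y) (v x) ν(dy)`. With `λ(s) = ∫ min(v,s) dν`,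
`H(s) = ∫ min(v,s) h dν` and `f = F - E_π F`, the Poisson equation reads `λ(v x) h x - H(v x) = f
x`, that is, `h = f / λ(v) + G(v)` with `G = H / λ`.

Convergence: symmetry of the kernel determines the Wronskian of `λ` and `H` from `f` alone
(`truncIntegral_wronskian`), so `G` is Lipschitz with a constant depending only on `‖f‖₁` and a
lower bound for `λ` (`abs_truncIntegral_div_sub_le`). As `v_i x → 1` and `λ_i(v_i x) → 1`, the
difference `h_i x - G_i 1` tends to `f x`, although nothing bounds `h_i` itself.

Existence: (A3) gives `v ≥ a > 0` on `{π > 0}`. Removing the mass `a ν` from every transition leaves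
an `L¹` contraction of factor `1 - a`, whose fixed point gives a solution (`exists_poisson`). -/

namespace IndepMetropolis

/-! ### Truncated integrals, their Wronskian, and the Lipschitz bound for their quotient -/

section Truncated

variable {S : Type*} [MeasurableSpace S] {ν : Measure S} {v f h : S → ℝ} {s t : ℝ}

/-- The integral `∫ min(v(y), s) h(y) ν(dy)`. -/
noncomputable def truncIntegral (ν : Measure S) (v h : S → ℝ) (s : ℝ) : ℝ :=
  ∫ y, min (v y) s * h y ∂ν

theorem integrable_min_mul (hv : Measurable v) (hv0 : ∀ y, 0 ≤ v y) (hh : Integrable h ν)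
    (hs : 0 ≤ s) : Integrable (fun y => min (v y) s * h y) ν := by
  refine hh.bdd_mul (c := s) (hv.min measurable_const).aestronglyMeasurable
    (Eventually.of_forall fun y => ?_)
  rw [Real.norm_eq_abs, abs_of_nonneg (le_min (hv0 y) hs)]
  exact min_le_right _ _

theorem abs_min_sub_min_le (a s t : ℝ) : |min a t - min a s| ≤ |t - s| := by
  simpa using abs_min_sub_min_le_max a t a s

theorem abs_truncIntegral_sub_le (hv : Measurable v) (hv0 : ∀ y, 0 ≤ v y) (hh : Integrable h ν)
    (hs : 0 ≤ s) (ht : 0 ≤ t) :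
    |truncIntegral ν v h t - truncIntegral ν v h s| ≤ |t - s| * ∫ y, |h y| ∂ν := by
  unfold truncIntegral
  rw [← integral_sub (integrable_min_mul hv hv0 hh ht) (integrable_min_mul hv hv0 hh hs),
    ← integral_const_mul]
  refine abs_integral_le_integral_abs.trans (integral_mono_of_nonneg
    (Eventually.of_forall fun _ => abs_nonneg _) (hh.abs.const_mul _)
    (Eventually.of_forall fun y => ?_))
  simp only
  rw [← sub_mul, abs_mul]
  exact mul_le_mul_of_nonneg_right (abs_min_sub_min_le _ _ _) (abs_nonneg _)

/-- The right derivative of `s ↦ min (v y) s` is the indicator of `s < v y`, and its slopes are at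
most 1 in absolute value, so `|h|` dominates. Only a one-sided derivative is available in general,
since `v` may have atoms. -/
theorem hasDerivWithinAt_truncIntegral (hv : Measurable v) (hv0 : ∀ y, 0 ≤ v y)
    (hh : Integrable h ν) (hs : 0 ≤ s) :
    HasDerivWithinAt (truncIntegral ν v h) (∫ y in {y | s < v y}, h y ∂ν) (Set.Ici s) s := by
  rw [← hasDerivWithinAt_Ioi_iff_Ici, hasDerivWithinAt_iff_tendsto_slope' (by simp),
    ← integral_indicator (measurableSet_lt measurable_const hv)]
  have hslope : ∀ᶠ t in 𝓝[>] s, ∫ y, slope (fun u => min (v y) u) s t * h y ∂ν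
      = slope (truncIntegral ν v h) s t := by
    filter_upwards [self_mem_nhdsWithin] with t ht
    have ht0 : 0 ≤ t := hs.trans (le_of_lt ht)
    simp only [slope_def_field, truncIntegral]
    rw [← integral_sub (integrable_min_mul hv hv0 hh ht0) (integrable_min_mul hv hv0 hh hs),
      ← integral_div]
    congr 1 with y
    ring
  refine Tendsto.congr' hslope ?_
  refine tendsto_integral_filter_of_dominated_convergence (fun y => |h y|) ?_ ?_ hh.abs ?_
  · refine Eventually.of_forall fun t => ?_
    simp only [slope_def_field]
    exact (Measurable.aestronglyMeasurable (by fun_prop)).mul hh.aestronglyMeasurable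
  · refine Eventually.of_forall fun t => Eventually.of_forall fun y => ?_
    rw [norm_mul, Real.norm_eq_abs, Real.norm_eq_abs, slope_def_field, abs_div]
    refine mul_le_of_le_one_left (abs_nonneg _) (div_le_one_of_le₀ ?_ (abs_nonneg _))
    exact abs_min_sub_min_le _ _ _
  · refine Eventually.of_forall fun y => ?_
    rcases lt_or_ge s (v y) with hy | hy
    · rw [Set.indicator_of_mem (show y ∈ {y | s < v y} from hy)]
      refine tendsto_const_nhds.congr' ?_
      filter_upwards [self_mem_nhdsWithin, mem_nhdsWithin_of_mem_nhds (Iio_mem_nhds hy)]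
        with t ht ht'
      have h1 : t - s ≠ 0 := sub_ne_zero.2 (ne_of_gt ht)
      rw [slope_def_field, min_eq_right (le_of_lt ht'), min_eq_right hy.le, div_self h1, one_mul]
    · rw [Set.indicator_of_notMem (show y ∉ {y | s < v y} from not_lt.2 hy)]
      refine tendsto_const_nhds.congr' ?_
      filter_upwards [self_mem_nhdsWithin] with t ht
      have ht : s < t := ht
      rw [slope_def_field, min_eq_left hy, min_eq_left (hy.trans ht.le)]
      simp

theorem integral_min_mul_sub [IsFiniteMeasure ν] (hv : Measurable v) (hv0 : ∀ y, 0 ≤ v y)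
    (hh : Integrable h ν) (hs : 0 ≤ s) (c : ℝ) :
    ∫ y, min (v y) s * (c - h y) ∂ν
      = truncIntegral ν v (fun _ => 1) s * c - truncIntegral ν v h s := by
  unfold truncIntegral
  rw [← integral_mul_const, ← integral_sub ((integrable_min_mul hv hv0
    (integrable_const 1) hs).mul_const c) (integrable_min_mul hv hv0 hh hs)]
  congr 1 with y
  ring

/-- `h` solves the equation `∫ min(v(y), v(x)) (h(x) - h(y)) ν(dy) = f(x)` for almost all `x`.
Integrating it over a sublevel set of `v` gives the Wronskian of the truncated integrals. -/
theorem truncIntegral_wronskian [IsFiniteMeasure ν] (hv : Measurable v) (hv0 : ∀ y, 0 ≤ v y)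
    (hh : Integrable h ν) (hs : 0 ≤ s)
    (heq : ∀ᵐ x ∂ν, ∫ y, min (v y) (v x) * (h x - h y) ∂ν = f x) :
    truncIntegral ν v (fun _ => 1) s * ∫ y in {y | s < v y}, h y ∂ν
      - truncIntegral ν v h s * ∫ _y in {y | s < v y}, (1 : ℝ) ∂ν
      = - ∫ x in {y | s < v y}ᶜ, f x ∂ν := by
  have hB : MeasurableSet {y | s < v y} := measurableSet_lt measurable_const hv
  set B : Set S := {y | s < v y} with hBdef
  -- The extra truncation at `s` makes the factor bounded, hence `K` integrable on products; it
  -- changes nothing when `v x ≤ s`.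
  let K : S → S → ℝ := fun x y => min (min (v y) (v x)) s * (h x - h y)
  have hKint : ∀ (ν₁ ν₂ : Measure S) [IsFiniteMeasure ν₁] [IsFiniteMeasure ν₂],
      Integrable h ν₁ → Integrable h ν₂ → Integrable (Function.uncurry K) (ν₁.prod ν₂) := by
    intro ν₁ ν₂ _ _ h1 h2
    refine Integrable.bdd_mul (c := s) ((h1.comp_fst ν₂).sub (h2.comp_snd ν₁))
      (f := fun z : S × S => min (min (v z.2) (v z.1)) s)
      (Measurable.aestronglyMeasurable (by fun_prop)) (Eventually.of_forall fun z => ?_)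
    rw [Real.norm_eq_abs, abs_of_nonneg (le_min (le_min (hv0 _) (hv0 _)) hs)]
    exact min_le_right _ _
  have hKx : ∀ x, Integrable (K x) ν := by
    intro x
    refine Integrable.bdd_mul (c := s) ((integrable_const (h x)).sub hh)
      (f := fun y => min (min (v y) (v x)) s)
      (Measurable.aestronglyMeasurable (by fun_prop)) (Eventually.of_forall fun z => ?_)
    rw [Real.norm_eq_abs, abs_of_nonneg (le_min (le_min (hv0 _) (hv0 _)) hs)]
    exact min_le_right _ _
  have hI1 := (hKint (ν.restrict Bᶜ) (ν.restrict Bᶜ) hh.integrableOn hh.integrableOn)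
  have hI2 := (hKint (ν.restrict Bᶜ) (ν.restrict B) hh.integrableOn hh.integrableOn)
  -- `K` is antisymmetric, so its integral over a square vanishes.
  have hzero : ∫ x in Bᶜ, ∫ y in Bᶜ, K x y ∂ν ∂ν = 0 := by
    have h1 := integral_integral_swap hI1
    have h2 : ∫ y in Bᶜ, ∫ x in Bᶜ, K x y ∂ν ∂ν = - ∫ x in Bᶜ, ∫ y in Bᶜ, K x y ∂ν ∂ν := by
      rw [← integral_neg]
      congr 1 with y
      rw [← integral_neg]
      congr 1 with x
      simp only [K]
      rw [min_comm (v y)]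
      ring
    linarith
  have hf : ∫ x in Bᶜ, f x ∂ν = ∫ x in Bᶜ, ∫ y in B, K x y ∂ν ∂ν := by
    calc ∫ x in Bᶜ, f x ∂ν = ∫ x in Bᶜ, (∫ y in B, K x y ∂ν + ∫ y in Bᶜ, K x y ∂ν) ∂ν := by
          refine setIntegral_congr_ae hB.compl ?_
          filter_upwards [heq] with x hx hxB
          rw [integral_add_compl hB (hKx x), ← hx]
          congr 1 with y
          have : min (v y) (v x) ≤ s := (min_le_right _ _).trans (not_lt.1 hxB)
          simp only [K, min_eq_left this]
      _ = _ := by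
          have h1 := integral_add hI2.integral_prod_left hI1.integral_prod_left
          simp only [Function.uncurry_apply_pair] at h1
          rw [h1, hzero, add_zero]
  -- For `v x ≤ s < v y` the minimum is `v x`, so the double integral splits into products.
  have hinner : ∫ x in Bᶜ, ∫ y in B, K x y ∂ν ∂ν
      = (∫ x in Bᶜ, min (v x) s * h x ∂ν) * (∫ _y in B, (1 : ℝ) ∂ν)
        - (∫ x in Bᶜ, min (v x) s * 1 ∂ν) * ∫ y in B, h y ∂ν := by
    rw [← integral_mul_const, ← integral_mul_const, ← integral_sub
      ((integrable_min_mul hv hv0 hh hs).integrableOn.mul_const _)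
      ((integrable_min_mul hv hv0 (integrable_const 1) hs).integrableOn.mul_const _)]
    refine setIntegral_congr_fun hB.compl fun x hx => ?_
    have h1 : ∫ y in B, K x y ∂ν
        = ∫ y in B, (min (v x) s * h x * 1 - min (v x) s * h y) ∂ν := by
      refine setIntegral_congr_fun hB fun y hy => ?_
      have hx' : v x ≤ s := not_lt.1 hx
      have hy' : s < v y := hy
      simp only [K]
      rw [min_eq_right (hx'.trans hy'.le)]
      ring
    rw [h1, integral_sub ((integrable_const _).mul_const _)
      (hh.integrableOn.const_mul _), integral_const_mul, integral_const_mul]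
    ring
  have hsplit : ∀ k : S → ℝ, Integrable k ν → truncIntegral ν v k s
      = s * ∫ y in B, k y ∂ν + ∫ y in Bᶜ, min (v y) s * k y ∂ν := by
    intro k hk
    rw [truncIntegral, ← integral_add_compl hB (integrable_min_mul hv hv0 hk hs),
      ← integral_const_mul]
    congr 1
    refine setIntegral_congr_fun hB fun y hy => ?_
    have hy' : s < v y := hy
    simp only [min_eq_right hy'.le]
  rw [hf, hinner, hsplit h hh, hsplit (fun _ => 1) (integrable_const 1)]
  ring

theorem truncIntegral_one_mono [IsFiniteMeasure ν] (hv : Measurable v) (hv0 : ∀ y, 0 ≤ v y)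
    (hs : 0 ≤ s) (hst : s ≤ t) :
    truncIntegral ν v (fun _ => 1) s ≤ truncIntegral ν v (fun _ => 1) t := by
  refine integral_mono (integrable_min_mul hv hv0 (integrable_const 1) hs)
    (integrable_min_mul hv hv0 (integrable_const 1) (hs.trans hst)) fun y => ?_
  simp only [mul_one]
  exact min_le_min_left _ hst

theorem continuousOn_truncIntegral (hv : Measurable v) (hv0 : ∀ y, 0 ≤ v y)
    (hh : Integrable h ν) : ContinuousOn (truncIntegral ν v h) (Set.Ici 0) := by
  refine LipschitzOnWith.continuousOn (K := (∫ y, |h y| ∂ν).toNNReal)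
    (LipschitzOnWith.of_dist_le_mul fun t ht s hs => ?_)
  rw [Real.coe_toNNReal _ (integral_nonneg fun _ => abs_nonneg _), Real.dist_eq, Real.dist_eq,
    mul_comm]
  exact abs_truncIntegral_sub_le hv hv0 hh hs ht

/-- By the quotient rule the right derivative of `H / λ` is the Wronskian over `λ²`, and the
Wronskian is at most `‖f‖₁` in absolute value. The bound does not involve `h`, hence is uniform
along a sequence of solutions. -/
theorem abs_truncIntegral_div_sub_le [IsFiniteMeasure ν] (hv : Measurable v)
    (hv0 : ∀ y, 0 ≤ v y) (hh : Integrable h ν) (hf : Integrable f ν)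
    (heq : ∀ᵐ x ∂ν, ∫ y, min (v y) (v x) * (h x - h y) ∂ν = f x) {r : ℝ} (hr : 0 ≤ r)
    {ℓ : ℝ} (hℓ : 0 < ℓ) (hℓr : ℓ ≤ truncIntegral ν v (fun _ => 1) r) (hrs : r ≤ s) (hst : s ≤ t) :
    |truncIntegral ν v h t / truncIntegral ν v (fun _ => 1) t
      - truncIntegral ν v h s / truncIntegral ν v (fun _ => 1) s|
      ≤ (∫ x, |f x| ∂ν) / ℓ ^ 2 * (t - s) := by
  have hpos : ∀ u, s ≤ u → ℓ ≤ truncIntegral ν v (fun _ => 1) u := fun u hu =>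
    hℓr.trans (truncIntegral_one_mono hv hv0 hr (hrs.trans hu))
  have hs0 : 0 ≤ s := hr.trans hrs
  refine norm_image_sub_le_of_norm_deriv_right_le_segment
    (f := fun u => truncIntegral ν v h u / truncIntegral ν v (fun _ => 1) u)
    (f' := fun u => (-∫ x in {y | u < v y}ᶜ, f x ∂ν) /
      truncIntegral ν v (fun _ => 1) u ^ 2) ?_ ?_ ?_ t ⟨hst, le_rfl⟩
  · have hsub : Set.Icc s t ⊆ Set.Ici 0 := fun u hu => hs0.trans hu.1
    exact ((continuousOn_truncIntegral hv hv0 hh).mono hsub).div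
      ((continuousOn_truncIntegral hv hv0 (integrable_const 1)).mono hsub)
      fun u hu => (hℓ.trans_le (hpos u hu.1)).ne'
  · intro u hu
    have hu0 := hs0.trans hu.1
    rw [← truncIntegral_wronskian hv hv0 hh hu0 heq]
    refine ((hasDerivWithinAt_truncIntegral hv hv0 hh hu0).fun_div
      (hasDerivWithinAt_truncIntegral hv hv0 (integrable_const 1) hu0)
      (hℓ.trans_le (hpos u hu.1)).ne').congr_deriv ?_
    ring
  · intro u hu
    rw [norm_div, norm_neg, norm_pow, Real.norm_eq_abs, Real.norm_eq_abs,
      abs_of_pos (hℓ.trans_le (hpos u hu.1))]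
    have h1 : |∫ x in {y | u < v y}ᶜ, f x ∂ν| ≤ ∫ x, |f x| ∂ν :=
      abs_integral_le_integral_abs.trans
        (setIntegral_le_integral hf.abs (Eventually.of_forall fun _ => abs_nonneg _))
    have := hpos u hu.1
    gcongr

end Truncated

end IndepMetropolis

namespace IndepMetropolis

/-! ### Solving the symmetrized Poisson equation by contraction in `L¹` -/

section Existence

variable {S : Type*} [MeasurableSpace S] {ν : Measure S} {v f g h : S → ℝ} {a s : ℝ}

theorem integrable_prod_min_mul [IsFiniteMeasure ν] (hv : Measurable v) (hv0 : ∀ y, 0 ≤ v y)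
    (hvi : Integrable v ν) (hg : Integrable g ν) :
    Integrable (Function.uncurry fun x y => min (v y) (v x) * g y) (ν.prod ν) := by
  refine (hvi.mul_prod hg).mono ?_ (Eventually.of_forall fun z => ?_)
  · exact (Measurable.aestronglyMeasurable (by fun_prop)).mul hg.aestronglyMeasurable.comp_snd
  · simp only [Function.uncurry, norm_mul, Real.norm_eq_abs]
    rw [abs_of_nonneg (le_min (hv0 _) (hv0 _)), abs_of_nonneg (hv0 _)]
    exact mul_le_mul_of_nonneg_right (min_le_right _ _) (abs_nonneg _)

theorem integrable_truncIntegral_comp [IsFiniteMeasure ν] (hv : Measurable v)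
    (hv0 : ∀ y, 0 ≤ v y) (hvi : Integrable v ν) (hg : Integrable g ν) :
    Integrable (fun x => truncIntegral ν v g (v x)) ν :=
  (integrable_prod_min_mul hv hv0 hvi hg).integral_prod_left

/-- Fubini and the symmetry of `min (v y) (v x)`: this is the invariance of `ν` in disguise. -/
theorem integral_truncIntegral_comp [IsFiniteMeasure ν] (hv : Measurable v)
    (hv0 : ∀ y, 0 ≤ v y) (hvi : Integrable v ν) (hg : Integrable g ν) :
    ∫ x, truncIntegral ν v g (v x) ∂ν
      = ∫ y, truncIntegral ν v (fun _ => 1) (v y) * g y ∂ν := by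
  unfold truncIntegral
  rw [integral_integral_swap (integrable_prod_min_mul hv hv0 hvi hg)]
  congr 1 with y
  rw [← integral_mul_const]
  congr 1 with x
  rw [min_comm, mul_one]

theorem min_le_truncIntegral_one [IsProbabilityMeasure ν] (hv : Measurable v)
    (hv0 : ∀ y, 0 ≤ v y) (hva : ∀ᵐ x ∂ν, a ≤ v x) (hs : 0 ≤ s) :
    min a s ≤ truncIntegral ν v (fun _ => 1) s := by
  have : ∫ _y, min a s ∂ν ≤ truncIntegral ν v (fun _ => 1) s := by
    refine integral_mono_ae (integrable_const _)
      (integrable_min_mul hv hv0 (integrable_const 1) hs) ?_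
    filter_upwards [hva] with x hx
    rw [mul_one]
    exact min_le_min_right _ hx
  simpa using this

theorem truncIntegral_one_nonneg (hv0 : ∀ y, 0 ≤ v y) (hs : 0 ≤ s) :
    0 ≤ truncIntegral ν v (fun _ => 1) s :=
  integral_nonneg fun y => mul_nonneg (le_min (hv0 y) hs) zero_le_one

theorem truncIntegral_one_le [IsFiniteMeasure ν] (hv : Measurable v) (hv0 : ∀ y, 0 ≤ v y)
    (hvi : Integrable v ν) (hs : 0 ≤ s) : truncIntegral ν v (fun _ => 1) s ≤ ∫ y, v y ∂ν := by
  refine integral_mono (integrable_min_mul hv hv0 (integrable_const 1) hs) hvi fun y => ?_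
  simp only [mul_one]
  exact min_le_left _ _

/-- The transition operator of the sampler, minus `a` times the projection onto the constants. -/
noncomputable def deflated (ν : Measure S) (v : S → ℝ) (a : ℝ) (g : S → ℝ) (x : S) : ℝ :=
  (1 - truncIntegral ν v (fun _ => 1) (v x)) * g x
    + (truncIntegral ν v g (v x) - a * ∫ y, g y ∂ν)

theorem integrable_truncIntegral_comp_mul [IsFiniteMeasure ν] (hv : Measurable v)
    (hv0 : ∀ y, 0 ≤ v y) (hvi : Integrable v ν) (hg : Integrable g ν) :
    Integrable (fun x => truncIntegral ν v (fun _ => 1) (v x) * g x) ν := by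
  refine hg.bdd_mul (c := ∫ y, v y ∂ν)
    (integrable_truncIntegral_comp hv hv0 hvi (integrable_const 1)).aestronglyMeasurable
    (Eventually.of_forall fun x => ?_)
  rw [Real.norm_eq_abs, abs_of_nonneg (truncIntegral_one_nonneg hv0 (hv0 x))]
  exact truncIntegral_one_le hv hv0 hvi (hv0 x)

theorem integrable_deflated [IsFiniteMeasure ν] (hv : Measurable v)
    (hv0 : ∀ y, 0 ≤ v y) (hvi : Integrable v ν) (hg : Integrable g ν) :
    Integrable (deflated ν v a g) ν := by
  unfold deflated
  simp_rw [sub_mul, one_mul]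
  exact (hg.sub (integrable_truncIntegral_comp_mul hv hv0 hvi hg)).add
    ((integrable_truncIntegral_comp hv hv0 hvi hg).sub (integrable_const _))

theorem integral_deflated [IsProbabilityMeasure ν] (hv : Measurable v)
    (hv0 : ∀ y, 0 ≤ v y) (hvi : Integrable v ν) (hg : Integrable g ν) :
    ∫ x, deflated ν v a g x ∂ν = (1 - a) * ∫ x, g x ∂ν := by
  have h1 := integrable_truncIntegral_comp_mul hv hv0 hvi hg
  have h2 := integrable_truncIntegral_comp hv hv0 hvi hg
  unfold deflated
  simp_rw [sub_mul, one_mul]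
  have h3 : Integrable (fun x => g x - truncIntegral ν v (fun _ => 1) (v x) * g x) ν := hg.sub h1
  have h4 : Integrable (fun x => truncIntegral ν v g (v x) - a * ∫ y, g y ∂ν) ν :=
    h2.sub (integrable_const _)
  rw [integral_add h3 h4, integral_sub hg h1, integral_sub h2 (integrable_const _), integral_truncIntegral_comp hv hv0 hvi hg]
  simp

theorem deflated_sub (hv : Measurable v) (hv0 : ∀ y, 0 ≤ v y)
    (hg : Integrable g ν) (hh : Integrable h ν) (x : S) :
    deflated ν v a g x - deflated ν v a h x = deflated ν v a (fun y => g y - h y) x := by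
  have h1 : truncIntegral ν v (fun y => g y - h y) (v x)
      = truncIntegral ν v g (v x) - truncIntegral ν v h (v x) := by
    unfold truncIntegral
    rw [← integral_sub (integrable_min_mul hv hv0 hg (hv0 x))
      (integrable_min_mul hv hv0 hh (hv0 x))]
    congr 1 with y
    ring
  unfold deflated
  rw [h1, integral_sub hg hh]
  ring

/-- The deflated operator is still positive: the rejection term has weight `1 - λ(v x) ≥ 0` because
`∫ v ≤ 1`, and the integral term has kernel `min (v y) (v x) - a ≥ 0`. -/
theorem abs_deflated_le [IsFiniteMeasure ν] (hv : Measurable v) (hv0 : ∀ y, 0 ≤ v y)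
    (hvi : Integrable v ν) (hv1 : ∫ y, v y ∂ν ≤ 1) (hva : ∀ᵐ x ∂ν, a ≤ v x)
    (hg : Integrable g ν) {x : S} (hx : a ≤ v x) :
    |deflated ν v a g x| ≤ deflated ν v a (fun y => |g y|) x := by
  have key : ∀ k : S → ℝ, Integrable k ν → truncIntegral ν v k (v x) - a * ∫ y, k y ∂ν
      = ∫ y, (min (v y) (v x) - a) * k y ∂ν := by
    intro k hk
    rw [truncIntegral, ← integral_const_mul, ← integral_sub
      (integrable_min_mul hv hv0 hk (hv0 x)) (hk.const_mul a)]
    congr 1 with y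
    ring
  unfold deflated
  rw [key g hg, key _ hg.abs]
  refine (abs_add_le _ _).trans (add_le_add ?_ ?_)
  · rw [abs_mul, abs_of_nonneg (sub_nonneg.2 ((truncIntegral_one_le hv hv0 hvi (hv0 x)).trans hv1))]
  · refine abs_integral_le_integral_abs.trans (le_of_eq (integral_congr_ae ?_))
    filter_upwards [hva] with y hy
    rw [abs_mul, abs_of_nonneg (sub_nonneg.2 (le_min hy hx))]

theorem integral_abs_deflated_le [IsProbabilityMeasure ν] (hv : Measurable v)
    (hv0 : ∀ y, 0 ≤ v y) (hvi : Integrable v ν) (hv1 : ∫ y, v y ∂ν ≤ 1)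
    (hva : ∀ᵐ x ∂ν, a ≤ v x) (hg : Integrable g ν) :
    ∫ x, |deflated ν v a g x| ∂ν ≤ (1 - a) * ∫ x, |g x| ∂ν := by
  rw [← integral_deflated hv hv0 hvi hg.abs]
  refine integral_mono_ae (integrable_deflated hv hv0 hvi hg).abs
    (integrable_deflated hv hv0 hvi hg.abs) ?_
  filter_upwards [hva] with x hx using abs_deflated_le hv hv0 hvi hv1 hva hg hx

theorem exists_eq_add_deflated [IsProbabilityMeasure ν] (hv : Measurable v)
    (hv0 : ∀ y, 0 ≤ v y) (hvi : Integrable v ν) (hv1 : ∫ y, v y ∂ν ≤ 1)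
    (ha : 0 < a) (hva : ∀ᵐ x ∂ν, a ≤ v x) (hf : Integrable f ν) :
    ∃ g : S → ℝ, Integrable g ν ∧ ∀ᵐ x ∂ν, g x = f x + deflated ν v a g x := by
  have ha1 : a ≤ 1 := by
    have : ∫ _x, a ∂ν ≤ ∫ x, v x ∂ν := integral_mono_ae (integrable_const _) hvi hva
    simp only [integral_const, probReal_univ, one_smul] at this
    exact this.trans hv1
  have hT : ∀ g : Lp ℝ 1 ν, Integrable (fun x => f x + deflated ν v a g x) ν := fun g =>
    hf.add (integrable_deflated hv hv0 hvi (L1.integrable_coeFn g))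
  let T : Lp ℝ 1 ν → Lp ℝ 1 ν := fun g => (hT g).toL1
  have hcon : ContractingWith (1 - a).toNNReal T := by
    refine ⟨by rw [Real.toNNReal_lt_one]; linarith, LipschitzWith.of_dist_le_mul fun g h => ?_⟩
    have hg := L1.integrable_coeFn g
    have hh := L1.integrable_coeFn h
    rw [Real.coe_toNNReal _ (by linarith), L1.dist_eq_integral_dist, L1.dist_eq_integral_dist]
    calc ∫ x, dist (T g x) (T h x) ∂ν
        = ∫ x, |deflated ν v a (fun y => g y - h y) x| ∂ν := by
          refine integral_congr_ae ?_
          filter_upwards [(hT g).coeFn_toL1, (hT h).coeFn_toL1] with x h1 h2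
          rw [h1, h2, Real.dist_eq, ← deflated_sub hv hv0 hg hh]
          congr 1
          ring
      _ ≤ (1 - a) * ∫ x, |g x - h x| ∂ν :=
          integral_abs_deflated_le hv hv0 hvi hv1 hva (hg.sub hh)
  have hfix := hcon.fixedPoint_isFixedPt
  set g := ContractingWith.fixedPoint T hcon
  refine ⟨g, L1.integrable_coeFn g, ?_⟩
  have h1 := (hT g).coeFn_toL1
  rwa [show (hT g).toL1 = g from hfix] at h1

theorem exists_poisson [IsProbabilityMeasure ν] (hv : Measurable v)
    (hv0 : ∀ y, 0 ≤ v y) (hvi : Integrable v ν) (hv1 : ∫ y, v y ∂ν ≤ 1)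
    (ha : 0 < a) (hva : ∀ᵐ x ∂ν, a ≤ v x) (hf : Integrable f ν) (hf0 : ∫ x, f x ∂ν = 0) :
    ∃ h : S → ℝ, Integrable h ν ∧
      ∀ x, 0 < v x → ∫ y, min (v y) (v x) * (h x - h y) ∂ν = f x := by
  obtain ⟨g, hg, hfix⟩ := exists_eq_add_deflated hv hv0 hvi hv1 ha hva hf
  -- Integrating the fixed-point equation gives `∫ g = (1 - a) ∫ g`, so the deflation term vanishes
  -- at `g`.
  have hg0 : ∫ y, g y ∂ν = 0 := by
    have h1 := integral_congr_ae hfix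
    rw [integral_add hf (integrable_deflated hv hv0 hvi hg),
      integral_deflated hv hv0 hvi hg, hf0] at h1
    have h2 : a * ∫ y, g y ∂ν = 0 := by linarith
    exact (mul_eq_zero.1 h2).resolve_left ha.ne'
  -- `g` satisfies the equation only almost everywhere; solving for the value at `x` changes `g` on
  -- a null set, which the integrals do not see, and gives the equation wherever `v x > 0`.
  let h : S → ℝ := fun x =>
    (f x + truncIntegral ν v g (v x)) / truncIntegral ν v (fun _ => 1) (v x)
  have hpos : ∀ x, 0 < v x → 0 < truncIntegral ν v (fun _ => 1) (v x) := fun x hx =>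
    (lt_min ha hx).trans_le (min_le_truncIntegral_one hv hv0 hva hx.le)
  have hgh : g =ᵐ[ν] h := by
    filter_upwards [hfix, hva] with x hx hxa
    rw [deflated, hg0] at hx
    rw [eq_div_iff (hpos x (ha.trans_le hxa)).ne']
    linarith
  have hh : Integrable h ν := hg.congr hgh
  refine ⟨h, hh, fun x hx => ?_⟩
  have htr : truncIntegral ν v h (v x) = truncIntegral ν v g (v x) := by
    refine integral_congr_ae ?_
    filter_upwards [hgh] with y hy
    rw [hy]
  rw [integral_min_mul_sub hv hv0 hh hx.le, htr, mul_div_cancel₀ _ (hpos x hx).ne']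
  ring

end Existence

end IndepMetropolis

namespace IndepMetropolis

/-! ### Translation of the sampler into the symmetric form -/

section Sampler

variable {S : Type*} [MeasurableSpace S] {μ : Measure S} {π q : Density μ} {F h W : S → ℝ}

theorem Density.integrable_toFun (p : Density μ) : Integrable p.toFun μ := by
  by_contra h
  have := p.integral_eq_one
  rw [integral_undef h] at this
  exact zero_ne_one this

theorem Density.integrable_measure_iff (p : Density μ) {g : S → ℝ} :
    Integrable g p.measure ↔ Integrable (fun x => g x * p x) μ := by
  rw [Density.measure, integrable_withDensity_iff p.measurable_toFun.ennreal_ofReal (by simp)]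
  simp only [ENNReal.toReal_ofReal (p.nonneg _)]

theorem Density.integral_measure (p : Density μ) (g : S → ℝ) :
    ∫ x, g x ∂p.measure = ∫ x, g x * p x ∂μ := by
  rw [Density.measure, integral_withDensity_eq_integral_toReal_smul
    p.measurable_toFun.ennreal_ofReal (by simp)]
  simp only [ENNReal.toReal_ofReal (p.nonneg _), smul_eq_mul, mul_comm]

theorem Density.ae_pos (p : Density μ) : ∀ᵐ x ∂p.measure, 0 < p x := by
  rw [Density.measure, ae_withDensity_iff p.measurable_toFun.ennreal_ofReal]
  refine Eventually.of_forall fun x hx => ?_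
  contrapose! hx
  exact ENNReal.ofReal_of_nonpos hx

theorem Density.exists_pos (p : Density μ) : ∃ x, 0 < p x := by
  obtain ⟨x, hx⟩ := p.ae_pos.exists
  exact ⟨x, hx⟩

/-- The inverse importance weight `q(x) / π(x)`. -/
noncomputable def invWeight (π q : Density μ) (x : S) : ℝ := q x / π x

theorem measurable_invWeight (π q : Density μ) : Measurable (invWeight π q) :=
  q.measurable_toFun.div π.measurable_toFun

theorem invWeight_nonneg (π q : Density μ) (x : S) : 0 ≤ invWeight π q x :=
  div_nonneg (q.nonneg x) (π.nonneg x)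

theorem invWeight_mul_le (π q : Density μ) (x : S) : invWeight π q x * π x ≤ q x := by
  unfold invWeight
  rcases (π.nonneg x).eq_or_lt with h | h
  · rw [← h, mul_zero]
    exact q.nonneg x
  · rw [div_mul_cancel₀ _ h.ne']

theorem integrable_invWeight_mul (π q : Density μ) :
    Integrable (fun x => invWeight π q x * π x) μ := by
  refine q.integrable_toFun.mono
    ((measurable_invWeight π q).mul π.measurable_toFun).aestronglyMeasurable
    (Eventually.of_forall fun x => ?_)
  rw [Real.norm_eq_abs, Real.norm_eq_abs, abs_of_nonneg (q.nonneg x),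
    abs_of_nonneg (mul_nonneg (invWeight_nonneg π q x) (π.nonneg x))]
  exact invWeight_mul_le π q x

theorem integrable_invWeight (π q : Density μ) : Integrable (invWeight π q) π.measure :=
  π.integrable_measure_iff.2 (integrable_invWeight_mul π q)

theorem integral_invWeight_le (π q : Density μ) : ∫ x, invWeight π q x ∂π.measure ≤ 1 := by
  rw [π.integral_measure, ← q.integral_eq_one]
  exact integral_mono (integrable_invWeight_mul π q) q.integrable_toFun (invWeight_mul_le π q)

theorem exists_le_invWeight (hw : wStar π q < ∞) :
    ∃ a, 0 < a ∧ ∀ x, 0 < π x → a ≤ invWeight π q x := by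
  have hC : 0 ≤ (wStar π q).toReal := ENNReal.toReal_nonneg
  -- The `+ 1` makes the denominator positive without first showing `wStar π q ≠ 0`.
  refine ⟨1 / ((wStar π q).toReal + 1), by positivity, fun x hx => ?_⟩
  have h1 : ENNReal.ofReal (π x) / ENNReal.ofReal (q x) ≤ wStar π q :=
    le_iSup (fun x => ENNReal.ofReal (π x) / ENNReal.ofReal (q x)) x
  rw [ENNReal.div_le_iff_le_mul (Or.inr hw.ne) (Or.inl ENNReal.ofReal_ne_top)] at h1
  have h2 := ENNReal.toReal_mono (ENNReal.mul_ne_top hw.ne ENNReal.ofReal_ne_top) h1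
  rw [ENNReal.toReal_mul, ENNReal.toReal_ofReal (π.nonneg x),
    ENNReal.toReal_ofReal (q.nonneg x)] at h2
  rw [invWeight, div_le_div_iff₀ (by positivity) hx]
  linarith [q.nonneg x]

theorem accept_mul_eq {x : S} (hx : 0 < π x) (y : S) :
    accept π q x y * q y = min (invWeight π q y) (invWeight π q x) * π y := by
  unfold accept invWeight
  rcases (π.nonneg y).eq_or_lt with hy | hy
  · rw [← hy]
    split_ifs with h
    · simp
    · have : q y = 0 := le_antisymm (nonpos_of_mul_nonpos_right (not_lt.1 h) hx) (q.nonneg y)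
      simp [this]
  · rcases (q.nonneg y).eq_or_lt with hqy | hqy
    · rw [← hqy, zero_div, min_eq_left (div_nonneg (q.nonneg x) hx.le), mul_zero, zero_mul]
    · rw [if_pos (mul_pos hx hqy), min_mul_of_nonneg _ _ hqy.le, min_mul_of_nonneg _ _ hy.le,
        one_mul, div_mul_cancel₀ _ hy.ne']
      congr 1
      field_simp

theorem isPoissonSolution_iff : IsPoissonSolution π q F h ↔ ∀ x, 0 < π x →
    Integrable (fun y => min (invWeight π q y) (invWeight π q x) * (h x - h y)) π.measure ∧
    ∫ y, min (invWeight π q y) (invWeight π q x) * (h x - h y) ∂π.measure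
      = F x - π.expect F := by
  refine forall_congr' fun x => forall_congr' fun hx => ?_
  have key : (fun y => accept π q x y * (h y - h x) * q y)
      = fun y => -(min (invWeight π q y) (invWeight π q x) * (h x - h y) * π y) := by
    funext y
    linear_combination (h y - h x) * accept_mul_eq (q := q) hx y
  rw [key, π.integrable_measure_iff, π.integral_measure, integral_neg]
  refine and_congr integrable_fun_neg_iff ⟨fun h => by linarith, fun h => by linarith⟩

theorem MomentBound.integrable (hb : MomentBound π q F W) (hF : Measurable F) :
    Integrable F π.measure := by
  obtain ⟨C, hC⟩ := hb.bddAbove_norm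
  have hW : ∀ x, |F x| ≤ C * |W x| ^ 4 := by
    intro x
    have h1 := hb.one_le_weight x
    have h2 : |F x| / W x ≤ C := hC ⟨x, rfl⟩
    have hC0 : 0 ≤ C := (div_nonneg (abs_nonneg _) (zero_le_one.trans h1)).trans h2
    rw [div_le_iff₀ (zero_lt_one.trans_le h1)] at h2
    rw [abs_of_nonneg (zero_le_one.trans h1)]
    exact h2.trans (mul_le_mul_of_nonneg_left (le_self_pow₀ h1 (by norm_num)) hC0)
  refine ((π.integrable_measure_iff.2 hb.integrable_target).const_mul C).mono'
    hF.aestronglyMeasurable (Eventually.of_forall hW)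

/-- Absolute convergence at a single `x` suffices: there the factor `min (v y) (v x)` is at least
`a`, so dividing by it keeps integrability. -/
theorem IsPoissonSolution.integrable {a : ℝ} (ha : 0 < a)
    (hva : ∀ x, 0 < π x → a ≤ invWeight π q x) (hh : IsPoissonSolution π q F h) :
    Integrable h π.measure := by
  obtain ⟨x, hx⟩ := π.exists_pos
  have h1 := (isPoissonSolution_iff.1 hh x hx).1
  have h2 : Integrable (fun y => (min (invWeight π q y) (invWeight π q x))⁻¹ *
      (min (invWeight π q y) (invWeight π q x) * (h x - h y))) π.measure := by
    refine h1.bdd_mul (c := a⁻¹) ?_ ?_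
    · exact ((measurable_invWeight π q).min measurable_const).inv.aestronglyMeasurable
    · filter_upwards [π.ae_pos] with y hy
      have h3 : a ≤ min (invWeight π q y) (invWeight π q x) := le_min (hva y hy) (hva x hx)
      rw [Real.norm_eq_abs, abs_of_nonneg (inv_nonneg.2 (ha.le.trans h3))]
      exact inv_anti₀ ha h3
  refine ((integrable_const (h x)).sub h2).congr ?_
  filter_upwards [π.ae_pos] with y hy
  have h3 : 0 < min (invWeight π q y) (invWeight π q x) :=
    lt_min (ha.trans_le (hva y hy)) (ha.trans_le (hva x hx))
  simp only [Pi.sub_apply]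
  rw [inv_mul_cancel_left₀ h3.ne']
  ring

theorem integral_sub_expect (hF : Integrable F π.measure) :
    ∫ x, (F x - π.expect F) ∂π.measure = 0 := by
  rw [integral_sub hF (integrable_const _), π.integral_measure]
  simp [Density.expect]

theorem exists_isPoissonSolution (hF : Integrable F π.measure) (hw : wStar π q < ∞) :
    ∃ h, IsPoissonSolution π q F h := by
  obtain ⟨a, ha, hva⟩ := exists_le_invWeight hw
  have hv := measurable_invWeight π q
  have hv0 := invWeight_nonneg π q
  obtain ⟨h, hh, heq⟩ := exists_poisson hv hv0 (integrable_invWeight π q)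
    (integral_invWeight_le π q) ha (π.ae_pos.mono fun x hx => hva x hx)
    (hF.sub (integrable_const (π.expect F))) (integral_sub_expect hF)
  exact ⟨h, isPoissonSolution_iff.2 fun x hx =>
    ⟨integrable_min_mul hv hv0 ((integrable_const _).sub hh) (hv0 x),
      heq x (ha.trans_le (hva x hx))⟩⟩

/-! ### Passage to the limit in `i` -/

theorem tendsto_invWeight {π : Density μ} {q : ℕ → Density μ}
    (hq : ∀ x, Tendsto (fun i => q i x) atTop (𝓝 (π x))) {x : S} (hx : 0 < π x) :
    Tendsto (fun i => invWeight π (q i) x) atTop (𝓝 1) := by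
  have := (hq x).div_const (π x)
  rwa [div_self hx.ne'] at this

theorem tendsto_truncIntegral_invWeight {π : Density μ} {q : ℕ → Density μ}
    (hq : ∀ x, Tendsto (fun i => q i x) atTop (𝓝 (π x))) {s : ℝ} (hs : 0 ≤ s) :
    Tendsto (fun i => truncIntegral π.measure (invWeight π (q i)) (fun _ => 1) s) atTop
      (𝓝 (min 1 s)) := by
  have h1 : ∫ _x, min 1 s * 1 ∂π.measure = min 1 s := by simp
  rw [← h1]
  refine tendsto_integral_of_dominated_convergence (fun _ => s)
    (fun i => (((measurable_invWeight π (q i)).min measurable_const).mul_const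
      1).aestronglyMeasurable) (integrable_const s)
    (fun i => Eventually.of_forall fun x => ?_) ?_
  · rw [mul_one, Real.norm_eq_abs, abs_of_nonneg (le_min (invWeight_nonneg _ _ _) hs)]
    exact min_le_right _ _
  · filter_upwards [π.ae_pos] with x hx
    exact ((tendsto_invWeight hq hx).min tendsto_const_nhds).mul_const 1

theorem tendsto_poissonSolution {π : Density μ} {q : ℕ → Density μ}
    (hq : ∀ x, Tendsto (fun i => q i x) atTop (𝓝 (π x))) (hF : Integrable F π.measure)
    (hw : ∀ i, wStar π (q i) < ∞) {h : ℕ → S → ℝ}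
    (hh : ∀ i, IsPoissonSolution π (q i) F (h i)) :
    ∃ a : ℕ → ℝ, ∀ x, 0 < π x →
      Tendsto (fun i => h i x + a i) atTop (𝓝 (F x - π.expect F)) := by
  let lam : ℕ → ℝ → ℝ := fun i => truncIntegral π.measure (invWeight π (q i)) fun _ => 1
  let G : ℕ → ℝ → ℝ := fun i s => truncIntegral π.measure (invWeight π (q i)) (h i) s / lam i s
  have hv := fun i => measurable_invWeight π (q i)
  have hv0 := fun i => invWeight_nonneg π (q i)
  have hf : Integrable (fun x => F x - π.expect F) π.measure := hF.sub (integrable_const _)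
  have hhi : ∀ i, Integrable (h i) π.measure := fun i => by
    obtain ⟨a, ha, hva⟩ := exists_le_invWeight (hw i)
    exact (hh i).integrable ha hva
  have heq : ∀ i, ∀ᵐ x ∂π.measure, ∫ y, min (invWeight π (q i) y) (invWeight π (q i) x) *
      (h i x - h i y) ∂π.measure = F x - π.expect F := fun i =>
    π.ae_pos.mono fun x hx => (isPoissonSolution_iff.1 (hh i) x hx).2
  -- The limit is `min 1 (1/2) = 1/2`. This lower bound on `[1/2, ∞)` makes the Lipschitz constant
  -- of `G i` independent of `i`.
  have hlam : ∀ᶠ i in atTop, 1 / 4 ≤ lam i (1 / 2) := by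
    refine ((tendsto_truncIntegral_invWeight hq (s := 1 / 2) (by norm_num)).eventually
      (lt_mem_nhds ?_)).mono fun i hi => hi.le
    rw [lt_min_iff]
    norm_num
  -- `G i` is evaluated at the limit 1 of `v_i x`, which is the same for all `x`; hence one
  -- translation serves every point.
  refine ⟨fun i => -G i 1, fun x hx => ?_⟩
  have hvx := tendsto_invWeight hq hx
  have hdist : Tendsto (fun i => |invWeight π (q i) x - 1|) atTop (𝓝 0) := by
    have := (hvx.sub_const 1).abs
    rwa [sub_self, abs_zero] at this
  have hhalf : ∀ᶠ i in atTop, 1 / 2 ≤ invWeight π (q i) x :=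
    (hvx.eventually (lt_mem_nhds (by norm_num))).mono fun i hi => hi.le
  have hlamx : Tendsto (fun i => lam i (invWeight π (q i) x)) atTop (𝓝 1) := by
    have h1 : Tendsto (fun i => lam i 1) atTop (𝓝 1) := by
      simpa using tendsto_truncIntegral_invWeight hq zero_le_one
    have h2 : Tendsto (fun i => lam i (invWeight π (q i) x) - lam i 1) atTop (𝓝 0) := by
      refine squeeze_zero_norm (fun i => ?_) hdist
      simpa using abs_truncIntegral_sub_le (hv i) (hv0 i)
        (integrable_const (μ := π.measure) (1 : ℝ)) zero_le_one (hv0 i x)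
    simpa using h2.add h1
  have hG : Tendsto (fun i => G i (invWeight π (q i) x) - G i 1) atTop (𝓝 0) := by
    set C := (∫ x, |F x - π.expect F| ∂π.measure) / (1 / 4) ^ 2
    have hC : Tendsto (fun i => C * |invWeight π (q i) x - 1|) atTop (𝓝 0) := by
      simpa using hdist.const_mul C
    refine squeeze_zero_norm' ?_ hC
    filter_upwards [hlam, hhalf] with i hi hi'
    rw [Real.norm_eq_abs]
    rcases le_total 1 (invWeight π (q i) x) with hle | hle
    · rw [abs_of_nonneg (sub_nonneg.2 hle)]
      exact abs_truncIntegral_div_sub_le (hv i) (hv0 i) (hhi i) hf (heq i) (by norm_num)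
        (by norm_num) hi (by norm_num) hle
    · rw [abs_sub_comm, abs_sub_comm _ (1 : ℝ), abs_of_nonneg (sub_nonneg.2 hle)]
      exact abs_truncIntegral_div_sub_le (hv i) (hv0 i) (hhi i) hf (heq i) (by norm_num)
        (by norm_num) hi hi' hle
  have hlim : Tendsto (fun i => (F x - π.expect F) / lam i (invWeight π (q i) x)
      + (G i (invWeight π (q i) x) - G i 1)) atTop (𝓝 (F x - π.expect F)) := by
    have h1 : Tendsto (fun i => (F x - π.expect F) / lam i (invWeight π (q i) x)) atTop
        (𝓝 ((F x - π.expect F) / 1)) := tendsto_const_nhds.div hlamx one_ne_zero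
    simpa using h1.add hG
  refine hlim.congr' ?_
  filter_upwards [hlamx.eventually (lt_mem_nhds zero_lt_one)] with i hi
  have h1 := (isPoissonSolution_iff.1 (hh i) x hx).2
  rw [integral_min_mul_sub (hv i) (hv0 i) (hhi i) (hv0 i x)] at h1
  have h2 : h i x = (F x - π.expect F) / lam i (invWeight π (q i) x)
      + G i (invWeight π (q i) x) := by
    rw [← add_div, eq_div_iff hi.ne', ← h1]
    simp only [lam]
    ring
  rw [h2]
  ring

end Sampler

end IndepMetropolis
theorem theorem1 (d : ℕ) (X : Set (EuclideanSpace ℝ (Fin d))) (hX : MeasurableSet X)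
    (π : IndepMetropolis.Density
      ((volume : Measure (EuclideanSpace ℝ (Fin d))).comap (Subtype.val : X → _)))
    (q : ℕ → IndepMetropolis.Density
      ((volume : Measure (EuclideanSpace ℝ (Fin d))).comap (Subtype.val : X → _)))
    (F : X → ℝ) (hF : Measurable F)
    (hq : ∀ x : X, Tendsto (fun i => q i x) atTop (𝓝 (π x)))
    (hA1 : ∀ i, IndepMetropolis.RegularChain π (q i))
    (W : ℕ → X → ℝ)
    (hA2 : ∀ i, IndepMetropolis.MomentBound π (q i) F (W i))
    (hA3 : ∀ i, IndepMetropolis.wStar π (q i) < ∞) :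
    (∀ i, ∃ h : X → ℝ, IndepMetropolis.IsPoissonSolution π (q i) F h) ∧
    ∀ Fhat : ℕ → X → ℝ,
      (∀ i, IndepMetropolis.IsPoissonSolution π (q i) F (Fhat i)) →
      ∃ (a : ℕ → ℝ) (c : ℝ), ∀ x : X, 0 < π x →
        Tendsto (fun i => Fhat i x + a i) atTop (𝓝 (F x + c)) := by
  have hFi : Integrable F π.measure := (hA2 0).integrable hF
  refine ⟨fun i => IndepMetropolis.exists_isPoissonSolution hFi (hA3 i), fun Fhat hFhat => ?_⟩
  obtain ⟨a, ha⟩ := IndepMetropolis.tendsto_poissonSolution hq hFi hA3 hFhat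
  exact ⟨a, -π.expect F, fun x hx => by simpa only [sub_eq_add_neg] using ha x hx⟩
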